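/- Let $T_H=(V_H,E_H,F_H)$ be the infinite hexagonal triangulation of the plane, i.e. the tiling of the plane by equilateral triangles with vertex set $V_H=\{m+n\omega: m,n\in\mathbb Z\}$, $\omega=e^{\pi i/3}$, in which two vertices are joined by an edge when their distance is $1$, and every vertex has degree $6$. A PL metric on $T_H$ is a function $l:E_H\to(0,\infty)$ that satisfies the strict triangle inequalities in every face. For $u:V_H\to\mathbb R$ let $u*l$ be given by $(u*l)_{ij}=e^{\frac12(u_i+u_j)}\,l_{ij}$, and let $d_{reg}\equiv 1$ be the regular metric. The discrete Gaussian curvature of a PL metric at a vertex $i$ is $K_i=2\pi-\sum_{\Delta ijk\in F_H}\theta_i^{jk}$, where $\theta_i^{jk}$ is the inner angle at $i$ of the Euclidean triangle $\Delta ijk$ with the given edge lengths. For $\phi:V_H\to\mathbb R$, a global solution of the combinatorial Yamabe flow with initial metric $\phi*d_{reg}$ is a family $u(t):V_H\to\mathbb R$, $t\in[0,\infty)$, such that $u(0)=\phi$ and, for all $t\ge 0$, $u(t)*d_{reg}$ is a PL metric and $$\frac{\mathrm d u_i}{\mathrm d t}(t)=-K_i\big(u(t)*d_{reg}\big)\qquad\text{for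 all } i\in V_H .$$ There is a universal constant $\epsilon_0>0$ such that for every $\phi\in\ell^2(V_H)$ with $\|\phi\|_{\ell^2}\le\epsilon_0$ the flow with initial metric $\phi*d_{reg}$ has a unique global solution $u(t)$. Moreover, $u(t)*d_{reg}$ converges to the regular metric as $t\to\infty$: the Dirichlet energy $\mathcal E(u(t))=\sum_{ij\in E_H}|u_i(t)-u_j(t)|^2$ is finite for every $t\ge 0$ and tends to $0$, and the edge lengths $(u(t)*d_{reg})_{ij}$ tend to $1$ uniformly in $ij\in E_H$. -/

import Mathlib

/-- Vertices of the infinite hexagonal triangulation `T_H` of the plane. The pair `(m, n)` stands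
for the point `m + n ω` of the complex plane, `ω = exp (π i / 3)`. -/
abbrev HexVertex : Type := ℤ × ℤ

/-- The 1-skeleton of `T_H`: two lattice points are joined by an edge when they are at Euclidean
distance `1`, i.e. when they differ by one of `±1`, `±ω`, `±(1 - ω)`. Every vertex has degree 6. -/
def hexGraph : SimpleGraph HexVertex where
  Adj i j := j - i ∈ ({(1, 0), (0, 1), (-1, 1), (-1, 0), (0, -1), (1, -1)} : Set HexVertex)
  symm := ⟨by
    intro i j h
    have e : i - j = -(j - i) := (neg_sub j i).symm
    simp only [Set.mem_insert_iff, Set.mem_singleton_iff] at h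
    rw [e]
    rcases h with h | h | h | h | h | h <;> rw [h] <;> simp⟩
  loopless := ⟨by
    intro i h
    simp [Prod.ext_iff] at h⟩

/-- `{i, j, k}` is a face of `T_H`. In this triangulation the faces are exactly the triples of
pairwise adjacent vertices. -/
def IsHexFace (i j k : HexVertex) : Prop :=
  hexGraph.Adj i j ∧ hexGraph.Adj j k ∧ hexGraph.Adj k i

/-- A PL metric on `T_H`: `l i j` is the length of the edge `ij` (the values of `l` at pairs of
vertices that are not adjacent are irrelevant). Lengths are positive and satisfy the strict
triangle inequalities in each face. -/
structure IsPLMetric (l : HexVertex → HexVertex → ℝ) : Prop where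
  symm : ∀ i j, hexGraph.Adj i j → l i j = l j i
  pos : ∀ i j, hexGraph.Adj i j → 0 < l i j
  triangle : ∀ i j k, IsHexFace i j k → l i j < l i k + l k j

/-- The regular metric `d_reg ≡ 1`. -/
def regularMetric : HexVertex → HexVertex → ℝ := fun _ _ => 1

/-- The discrete conformal change `u ∗ l`. -/
noncomputable def conformalChange (u : HexVertex → ℝ) (l : HexVertex → HexVertex → ℝ) :
    HexVertex → HexVertex → ℝ :=
  fun i j => Real.exp ((u i + u j) / 2) * l i j

/-- The inner angle at the vertex `i` of the Euclidean triangle `ijk` with edge lengths given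
by `l` (law of cosines). -/
noncomputable def innerAngle (l : HexVertex → HexVertex → ℝ) (i j k : HexVertex) : ℝ :=
  Real.arccos ((l i j ^ 2 + l i k ^ 2 - l j k ^ 2) / (2 * l i j * l i k))

/-- The discrete Gaussian curvature `K_i = 2π - ∑ θ_i^{jk}`, the sum running over the faces that
contain `i`. The finite sum below runs over the ordered pairs `(j, k)` such that `ijk` is a face,
so it counts every face at `i` twice, whence the factor `1 / 2`. -/
noncomputable def discreteCurvature (l : HexVertex → HexVertex → ℝ) (i : HexVertex) : ℝ :=
  2 * Real.pi -
    (1 / 2) * ∑ᶠ p ∈ {p : HexVertex × HexVertex | IsHexFace i p.1 p.2}, innerAngle l i p.1 p.2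

/-- `u` is a global solution (for all times `t ≥ 0`) of the combinatorial Yamabe flow
`du_i/dt = -K_i(u ∗ d_reg)` with `u(0) = φ`. Only the values `u t` for `t ≥ 0` matter; the
derivative at `t = 0` is one-sided. -/
structure IsGlobalYamabeFlow (φ : HexVertex → ℝ) (u : ℝ → HexVertex → ℝ) : Prop where
  initial : u 0 = φ
  metric : ∀ t, 0 ≤ t → IsPLMetric (conformalChange (u t) regularMetric)
  flow : ∀ t, 0 ≤ t → ∀ i, HasDerivWithinAt (fun s => u s i)
    (-discreteCurvature (conformalChange (u t) regularMetric) i) (Set.Ici 0) t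

/-- `|u_i - u_j|²` as a function of the unordered pair `ij`. -/
def edgeDiffSq (u : HexVertex → ℝ) : Sym2 HexVertex → ℝ :=
  Sym2.lift ⟨fun i j => |u i - u j| ^ 2, fun i j => by simp only [abs_sub_comm]⟩

/-- The Dirichlet energy `∑_{ij ∈ E_H} |u_i - u_j|²`. -/
noncomputable def dirichletEnergy (u : HexVertex → ℝ) : ℝ :=
  ∑' e : hexGraph.edgeSet, edgeDiffSq u e

/-!
In the coordinates `u_j - u_i` the angle at `i` is a function of the differences of `u` along the
two edges at `i`, with linearization `π / 3 + ((u_j - u_i) + (u_k - u_i)) / (2 √3)` at the regular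
metric. Hence `-K_i` is `1 / √3` times the graph Laplacian plus an error that is quadratic in the
differences, and the flow is an ordinary differential equation in `ℓ²` with a vector field `G` that
is Lipschitz near the origin. As `⟪u, Δ_d u⟫ = -‖Δ_d u‖² / 2` for every lattice direction `d`, the
quadratic error is absorbed for small `u`, which leaves `⟪u, G u⟫ ≤ -(1 / 8) ∑_d ‖Δ_d u‖²`.

So `‖u(t)‖` does not increase: the flow stays in a small ball and exists for all times. Along it
`t ↦ ‖Δ_d u(t)‖²` is integrable and `Δ_d u(t)` is Lipschitz in time, so `Δ_d u(t) → 0`, which is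
the decay of the Dirichlet energy. Uniform convergence follows from the one-dimensional inequality
`|u_i|² ≤ 2 ‖Δ_d u‖ ‖u‖`, obtained by telescoping `u²` along the ray `i + ℕ d`.

A competing solution is not known to lie in `ℓ²`, so uniqueness is proved in the supremum norm. The
curvature is bounded, which keeps a solution that agrees with `u` at some time bounded for a short
time of fixed length, and a contraction on such intervals then makes it agree with `u` there.
-/

open Bornology Filter Metric Set Topology
open scoped ENNReal NNReal RealInnerProductSpace fwdDiff lp

lemma isBigO_sub_fderiv_sq_of_contDiffAt {E F : Type*} [NormedAddCommGroup E] [NormedSpace ℝ E]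
    [NormedAddCommGroup F] [NormedSpace ℝ F] {f : E → F} {a : E} (hf : ContDiffAt ℝ 2 f a) :
    (fun x => f x - f a - fderiv ℝ f a (x - a)) =O[𝓝 a] fun x => ‖x - a‖ ^ 2 := by
  obtain ⟨K, t, ht, hK⟩ := (hf.fderiv_right (m := 1) (by norm_num)).exists_lipschitzOnWith
  have hd : ∀ᶠ x in 𝓝 a, DifferentiableAt ℝ f x :=
    (hf.eventually (by simp)).mono fun x hx => hx.differentiableAt (by norm_num)
  obtain ⟨r, hr, hrt⟩ := Metric.mem_nhds_iff.1 (inter_mem ht hd)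
  refine .of_bound K (eventually_of_mem (ball_mem_nhds a hr) fun x hx => ?_)
  have hsub : closedBall a ‖x - a‖ ⊆ ball a r :=
    closedBall_subset_ball (by rwa [← dist_eq_norm, ← mem_ball])
  have hderiv : ∀ y ∈ closedBall a ‖x - a‖, ‖fderiv ℝ f y - fderiv ℝ f a‖ ≤ K * ‖x - a‖ :=
    fun y hy => (hK.norm_sub_le (hrt (hsub hy)).1 (hrt (mem_ball_self hr)).1).trans <| by
      gcongr
      rwa [← dist_eq_norm, ← mem_closedBall]
  calc ‖f x - f a - fderiv ℝ f a (x - a)‖ ≤ K * ‖x - a‖ * ‖x - a‖ :=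
        (convex_closedBall a ‖x - a‖).norm_image_sub_le_of_norm_hasFDerivWithin_le'
          (fun y hy => (hrt (hsub hy)).2.hasFDerivAt.hasFDerivWithinAt) hderiv
          (mem_closedBall_self (norm_nonneg _)) (mem_closedBall_iff_norm.2 le_rfl)
    _ = K * ‖‖x - a‖ ^ 2‖ := by rw [norm_pow, norm_norm]; ring

lemma exists_norm_le_of_lipschitzOnWith {X F : Type*} [PseudoMetricSpace X]
    [SeminormedAddCommGroup F] {f : X → F} {K : ℝ≥0} {s : Set X} (hf : LipschitzOnWith K f s)
    (hs : IsBounded s) : ∃ M : ℝ≥0, ∀ x ∈ s, ‖f x‖ ≤ M := by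
  obtain ⟨C, hC⟩ := isBounded_iff.1 hs
  have him : IsBounded (f '' s) := isBounded_image_iff.2 ⟨K * C, fun x hx y hy =>
    (hf.dist_le_mul x hx y hy).trans (by gcongr; exact hC hx hy)⟩
  obtain ⟨M, hM⟩ := him.exists_norm_le
  exact ⟨M.toNNReal, fun x hx => (hM _ (mem_image_of_mem f hx)).trans M.le_coe_toNNReal⟩

section RadialRetraction

variable {E : Type*} [NormedAddCommGroup E] [NormedSpace ℝ E] {r : ℝ}

/-- The radial retraction of a normed space onto the closed ball of radius `r > 0` about the
origin. -/
noncomputable def radialRetraction (r : ℝ) (x : E) : E := (r / max r ‖x‖) • x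

lemma radialRetraction_of_mem_closedBall (hr : 0 < r) {x : E} (hx : x ∈ closedBall 0 r) :
    radialRetraction r x = x := by
  rw [radialRetraction, max_eq_left (mem_closedBall_zero_iff.1 hx), div_self hr.ne', one_smul]

lemma radialRetraction_mem_closedBall (hr : 0 < r) (x : E) :
    radialRetraction r x ∈ closedBall 0 r := by
  have hm : 0 < max r ‖x‖ := lt_max_of_lt_left hr
  rw [mem_closedBall_zero_iff, radialRetraction, norm_smul, Real.norm_of_nonneg (by positivity),
    div_mul_eq_mul_div, div_le_iff₀ hm]
  gcongr
  exact le_max_right _ _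

lemma lipschitzWith_radialRetraction (hr : 0 < r) :
    LipschitzWith 2 (radialRetraction r : E → E) := by
  refine LipschitzWith.of_dist_le_mul fun x y => ?_
  have hx : 0 < max r ‖x‖ := lt_max_of_lt_left hr
  have hsplit : radialRetraction r x - radialRetraction r y =
      (r / max r ‖x‖) • (x - y) + ((max r ‖y‖ - max r ‖x‖) / max r ‖x‖) • radialRetraction r y := by
    rw [radialRetraction, radialRetraction, smul_smul, smul_sub, sub_add, ← sub_smul]
    congr 2
    field_simp
    ring
  have hscale : ‖(r / max r ‖x‖) • (x - y)‖ ≤ ‖x - y‖ := by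
    rw [norm_smul, Real.norm_of_nonneg (by positivity)]
    exact mul_le_of_le_one_left (norm_nonneg _) ((div_le_one hx).2 (le_max_left _ _))
  have hmax : |max r ‖y‖ - max r ‖x‖| ≤ ‖x - y‖ := by
    rw [norm_sub_rev, max_comm r, max_comm r]
    exact (abs_max_sub_max_le_abs _ _ _).trans (abs_norm_sub_norm_le y x)
  have hradial : ‖((max r ‖y‖ - max r ‖x‖) / max r ‖x‖) • radialRetraction r y‖ ≤ ‖x - y‖ := by
    have hry := mem_closedBall_zero_iff.1 (radialRetraction_mem_closedBall hr y)
    rw [norm_smul, norm_div, Real.norm_of_nonneg hx.le, div_mul_eq_mul_div, div_le_iff₀ hx]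
    exact mul_le_mul hmax (hry.trans (le_max_left _ _)) (norm_nonneg _) (norm_nonneg _)
  rw [dist_eq_norm, dist_eq_norm, hsplit, NNReal.coe_ofNat, two_mul]
  exact norm_add_le_of_le hscale hradial

end RadialRetraction

section IntegralCurves

variable {E : Type*} [NormedAddCommGroup E] [NormedSpace ℝ E] {G : E → E} {K M : ℝ≥0}

lemma eqOn_Icc_of_isIntegralCurveOn (hG : LipschitzWith K G) {α β : ℝ → E} {a b : ℝ}
    (hα : IsIntegralCurveOn α (fun _ => G) (Icc a b))
    (hβ : IsIntegralCurveOn β (fun _ => G) (Icc a b)) (h : α a = β a) : EqOn α β (Icc a b) :=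
  have right_deriv {γ : ℝ → E} (hγ : IsIntegralCurveOn γ (fun _ => G) (Icc a b)) :
      ∀ t ∈ Ico a b, HasDerivWithinAt γ (G (γ t)) (Ici t) t := fun t ht =>
    (hγ t (Ico_subset_Icc_self ht)).mono_of_mem_nhdsWithin (Icc_mem_nhdsGE_of_mem ht)
  ODE_solution_unique_of_mem_Icc_right (v := fun _ => G) (s := fun _ => univ)
    (fun _ _ => hG.lipschitzOnWith) hα.continuousOn (right_deriv hα) (fun _ _ => mem_univ _)
    hβ.continuousOn (right_deriv hβ) (fun _ _ => mem_univ _) h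

lemma exists_isIntegralCurveOn_Icc [CompleteSpace E] (hG : LipschitzWith K G)
    (hM : ∀ x, ‖G x‖ ≤ M) (x₀ : E) (T : ℝ≥0) :
    ∃ α : ℝ → E, α 0 = x₀ ∧ IsIntegralCurveOn α (fun _ => G) (Icc 0 T) := by
  have hPL : IsPicardLindelof (fun _ => G) (tmin := 0) (tmax := T) ⟨0, by simp⟩ x₀ (M * T) 0 M K :=
    { lipschitzOnWith := fun _ _ => hG.lipschitzOnWith
      continuousOn := fun _ _ => continuousOn_const
      norm_le := fun _ _ x _ => hM x
      mul_max_le := by simp }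
  exact hPL.exists_eq_forall_mem_Icc_hasDerivWithinAt₀

lemma exists_isIntegralCurveOn_Ici [CompleteSpace E] (hG : LipschitzWith K G)
    (hM : ∀ x, ‖G x‖ ≤ M) (x₀ : E) :
    ∃ α : ℝ → E, α 0 = x₀ ∧ IsIntegralCurveOn α (fun _ => G) (Ici 0) := by
  choose α hα₀ hα using fun n : ℕ => exists_isIntegralCurveOn_Icc hG hM x₀ n
  have hmono {m n : ℕ} (hmn : m ≤ n) : EqOn (α m) (α n) (Icc 0 (m : ℝ≥0)) :=
    eqOn_Icc_of_isIntegralCurveOn hG (hα m)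
      ((hα n).mono (Icc_subset_Icc_right (by exact_mod_cast hmn))) ((hα₀ m).trans (hα₀ n).symm)
  have hglue (n : ℕ) : EqOn (fun t => α ⌈t⌉₊ t) (α n) (Icc 0 (n : ℝ≥0)) := fun t ht =>
    hmono (Nat.ceil_le.2 (by exact_mod_cast ht.2)) ⟨ht.1, by exact_mod_cast Nat.le_ceil t⟩
  refine ⟨fun t => α ⌈t⌉₊ t, hα₀ _, fun t ht => ?_⟩
  obtain ⟨n, hn⟩ := exists_nat_gt t
  have htn : t ∈ Icc (0 : ℝ) (n : ℝ≥0) := ⟨ht, by exact_mod_cast hn.le⟩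
  refine (((hα n t htn).congr_of_mem (hglue n) htn).congr_deriv
    (congrArg G (hglue n htn).symm)).mono_of_mem_nhdsWithin ?_
  rw [← Ici_inter_Iic]
  exact inter_mem self_mem_nhdsWithin
    (mem_nhdsWithin_of_mem_nhds (Iic_mem_nhds (by exact_mod_cast hn)))

end IntegralCurves

lemma sub_le_mul_sub_of_hasDerivWithinAt_le {f f' : ℝ → ℝ} {a b C : ℝ}
    (hf : ∀ t ∈ Icc a b, HasDerivWithinAt f (f' t) (Icc a b) t) (hC : ∀ t ∈ Icc a b, f' t ≤ C)
    (hab : a ≤ b) : f b - f a ≤ C * (b - a) := by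
  have hline (t : ℝ) : HasDerivAt (fun s => f a + C * (s - a)) C t := by
    simpa using (((hasDerivAt_id t).sub_const a).const_mul C).const_add (f a)
  have hle := image_le_of_deriv_right_le_deriv_boundary
    (fun t ht => (hf t ht).continuousWithinAt)
    (fun t ht => (hf t (Ico_subset_Icc_self ht)).mono_of_mem_nhdsWithin (Icc_mem_nhdsGE_of_mem ht))
    (by simp) (fun t _ => (hline t).continuousAt.continuousWithinAt)
    (fun t _ => (hline t).hasDerivWithinAt) (fun t ht => hC t (Ico_subset_Icc_self ht))
    (right_mem_Icc.2 hab)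
  linarith

lemma half_sq_le_sq_of_lipschitzOnWith {X : Type*} [PseudoMetricSpace X] {g : X → ℝ} {M : ℝ≥0}
    {s : Set X} (hg : LipschitzOnWith M g s) {x y : X} (hx : x ∈ s) (hy : y ∈ s) {ε : ℝ}
    (hε : 0 ≤ ε) (hxy : M * dist x y ≤ ε / 2) (hgx : ε ≤ |g x|) : (ε / 2) ^ 2 ≤ g y ^ 2 := by
  have hlip : |g x - g y| ≤ M * dist x y := hg.dist_le_mul x hx y hy
  rw [← sq_abs (g y)]
  gcongr
  linarith [abs_sub_abs_le_abs_sub (g x) (g y)]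

lemma tendsto_zero_of_hasDerivWithinAt_le_neg_sq {N N' g : ℝ → ℝ} {c : ℝ} {M : ℝ≥0} (hc : 0 < c)
    (hN : ∀ t ∈ Ici 0, HasDerivWithinAt N (N' t) (Ici 0) t) (hN₀ : ∀ t ∈ Ici 0, 0 ≤ N t)
    (hN' : ∀ t ∈ Ici 0, N' t ≤ -c * g t ^ 2) (hg : LipschitzOnWith M g (Ici 0)) :
    Tendsto g atTop (𝓝 0) := by
  have hdrop {a b m : ℝ} (ha : 0 ≤ a) (hab : a ≤ b) (hm : ∀ t ∈ Icc a b, m ≤ g t ^ 2) :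
      N b - N a ≤ -c * m * (b - a) := by
    have hsub : Icc a b ⊆ Ici 0 := fun t ht => ha.trans ht.1
    exact sub_le_mul_sub_of_hasDerivWithinAt_le (fun t ht => (hN t (hsub ht)).mono hsub)
      (fun t ht => (hN' t (hsub ht)).trans (mul_le_mul_of_nonpos_left (hm t ht) (by linarith))) hab
  have hanti : Antitone fun t => N (max t 0) := fun s t hst => by
    simpa using hdrop (le_max_right s 0) (max_le_max_right 0 hst) fun t _ => sq_nonneg (g t)
  have hlim := tendsto_atTop_ciInf hanti ⟨0, by
    rintro _ ⟨t, rfl⟩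
    exact hN₀ _ (le_max_right t 0)⟩
  refine Metric.tendsto_atTop.2 fun ε hε => ?_
  obtain ⟨δ, hδ, hδε⟩ := exists_pos_mul_lt (half_pos hε) M
  have hdiff : Tendsto (fun t => N (max t 0) - N (max (t + δ) 0)) atTop (𝓝 0) := by
    simpa using hlim.sub (hlim.comp (tendsto_atTop_add_const_right _ δ tendsto_id))
  obtain ⟨T, hT⟩ := eventually_atTop.1
    (hdiff.eventually (gt_mem_nhds (show 0 < c * (ε / 2) ^ 2 * δ by positivity)))
  refine ⟨max T 0, fun t ht => ?_⟩
  have ht₀ : 0 ≤ t := (le_max_right _ _).trans ht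
  have hsmall := hT t ((le_max_left _ _).trans ht)
  rw [max_eq_left ht₀, max_eq_left (by positivity)] at hsmall
  by_contra! hlarge
  rw [Real.dist_0_eq_abs] at hlarge
  -- A large value of `g` persists for time `δ`, and costs `N` more than it can still lose.
  have hpersist : ∀ s ∈ Icc t (t + δ), (ε / 2) ^ 2 ≤ g s ^ 2 := fun s hs => by
    refine half_sq_le_sq_of_lipschitzOnWith hg ht₀ (ht₀.trans hs.1) hε.le
      (le_trans ?_ hδε.le) hlarge
    rw [dist_comm, Real.dist_eq, abs_of_nonneg (sub_nonneg.2 hs.1)]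
    gcongr
    exact sub_le_iff_le_add'.2 hs.2
  have hcost := hdrop ht₀ (le_add_of_nonneg_right hδ.le) hpersist
  rw [add_sub_cancel_left] at hcost
  linarith

section DissipativeFields

variable {H : Type*} [NormedAddCommGroup H] [InnerProductSpace ℝ H] {G : H → H} {K : ℝ≥0} {ρ : ℝ}

lemma antitoneOn_norm_of_isIntegralCurveOn_Ici (hG : ∀ x, ⟪x, G x⟫ ≤ 0) {α : ℝ → H} {a : ℝ}
    (hα : IsIntegralCurveOn α (fun _ => G) (Ici a)) : AntitoneOn (fun t => ‖α t‖) (Ici a) := by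
  have hsq : AntitoneOn (fun t => ‖α t‖ ^ 2) (Ici a) :=
    antitoneOn_of_hasDerivWithinAt_nonpos (convex_Ici a) (hα.continuousOn.norm.pow 2)
      (fun t ht => ((hα t (interior_subset ht)).norm_sq).mono interior_subset)
      fun t _ => mul_nonpos_of_nonneg_of_nonpos two_pos.le (hG (α t))
  exact fun s hs t ht hst => le_of_sq_le_sq (hsq hs ht hst) (norm_nonneg _)

lemma exists_isIntegralCurveOn_Ici_mapsTo_closedBall [CompleteSpace H] (hρ : 0 < ρ)
    (hG : LipschitzOnWith K G (closedBall 0 ρ)) (hGρ : ∀ x ∈ closedBall 0 ρ, ⟪x, G x⟫ ≤ 0) {x₀ : H}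
    (hx₀ : x₀ ∈ closedBall 0 ρ) :
    ∃ α : ℝ → H, α 0 = x₀ ∧ IsIntegralCurveOn α (fun _ => G) (Ici 0) ∧
      MapsTo α (Ici 0) (closedBall 0 ρ) := by
  have hP (x : H) : radialRetraction ρ x ∈ closedBall 0 ρ := radialRetraction_mem_closedBall hρ x
  obtain ⟨M, hM⟩ := exists_norm_le_of_lipschitzOnWith hG isBounded_closedBall
  have hGP : LipschitzWith (K * 2) (G ∘ radialRetraction ρ) := lipschitzOnWith_univ.1 <|
    hG.comp (lipschitzWith_radialRetraction hρ).lipschitzOnWith fun x _ => hP x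
  obtain ⟨α, hα₀, hα⟩ := exists_isIntegralCurveOn_Ici hGP (fun x => hM _ (hP x)) x₀
  have hinner (x : H) : ⟪x, G (radialRetraction ρ x)⟫ ≤ 0 := by
    have hPx := hGρ _ (hP x)
    nth_rw 1 [radialRetraction] at hPx
    rw [real_inner_smul_left] at hPx
    exact nonpos_of_mul_nonpos_right hPx (div_pos hρ (lt_max_of_lt_left hρ))
  have hball : MapsTo α (Ici 0) (closedBall 0 ρ) := fun t ht => mem_closedBall_zero_iff.2 <|
    (antitoneOn_norm_of_isIntegralCurveOn_Ici hinner hα self_mem_Ici ht ht).trans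
      (by simpa only [hα₀, mem_closedBall_zero_iff] using hx₀)
  refine ⟨α, hα₀, fun t ht => ?_, hball⟩
  simpa only [Function.comp_apply, radialRetraction_of_mem_closedBall hρ (hball ht)] using hα t ht

lemma tendsto_zero_of_inner_le_neg_norm_sq {F : Type*} [NormedAddCommGroup F] [NormedSpace ℝ F]
    (L : H →L[ℝ] F) {s : Set H} {c : ℝ} {M : ℝ≥0} (hc : 0 < c) (hM : ∀ x ∈ s, ‖G x‖ ≤ M)
    (hG : ∀ x ∈ s, ⟪x, G x⟫ ≤ -c * ‖L x‖ ^ 2) {α : ℝ → H}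
    (hα : IsIntegralCurveOn α (fun _ => G) (Ici 0)) (hs : MapsTo α (Ici 0) s) :
    Tendsto (fun t => L (α t)) atTop (𝓝 0) := by
  have hlip : LipschitzOnWith M α (Ici 0) :=
    (convex_Ici 0).lipschitzOnWith_of_nnnorm_hasDerivWithin_le hα fun t ht => hM _ (hs ht)
  refine tendsto_zero_iff_norm_tendsto_zero.2 <| tendsto_zero_of_hasDerivWithinAt_le_neg_sq
    (c := 2 * c) (by positivity) (fun t ht => (hα t ht).norm_sq) (fun _ _ => sq_nonneg _)
    (fun t ht => ?_)
    (lipschitzWith_one_norm.comp_lipschitzOnWith (L.lipschitz.comp_lipschitzOnWith hlip))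
  linarith [hG _ (hs ht)]

end DissipativeFields

section CoordinatewiseUniqueness

lemma nonpos_of_forall_le_imp_le_half {X : Type*} {f : X → ℝ} (hf : BddAbove (range f))
    (h : ∀ M, (∀ x, f x ≤ M) → ∀ x, f x ≤ M / 2) (x : X) : f x ≤ 0 := by
  have : Nonempty X := ⟨x⟩
  have hsup : ⨆ y, f y ≤ (⨆ y, f y) / 2 := ciSup_le (h _ (le_ciSup hf))
  linarith [le_ciSup hf x]

lemma forall_nonneg_of_forall_mem_Icc_add {P : ℝ → Prop} {c : ℝ} (hc : 0 < c) (h₀ : P 0)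
    (hstep : ∀ a, 0 ≤ a → P a → ∀ t ∈ Icc a (a + c), P t) {t : ℝ} (ht : 0 ≤ t) : P t := by
  obtain ⟨n, hn⟩ := exists_nat_gt (t / c)
  have hn₀ : (0 : ℝ) < n := (by positivity : 0 ≤ t / c).trans_lt hn
  have hmul (k : ℕ) : P (k * (t / n)) := by
    induction k with
    | zero => simpa using h₀
    | succ k ih =>
      have htn : t / n ≤ c := by rw [div_le_iff₀ hn₀]; exact ((div_lt_iff₀' hc).1 hn).le
      have htn₀ : 0 ≤ t / n := div_nonneg ht hn₀.le
      refine hstep _ (by positivity) ih _ ⟨?_, ?_⟩ <;> push_cast <;> linarith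
  simpa [mul_div_cancel₀ t hn₀.ne'] using hmul n

variable {ι E : Type*} [NormedAddCommGroup E] [NormedSpace ℝ E] {F : (ι → E) → ι → E} {B : ℝ}
  {L : ℝ≥0} {R R' : ℝ} {u v : ℝ → ι → E}

lemma norm_apply_le_of_hasDerivWithinAt_Ici (hF : ∀ x i, ‖F x i‖ ≤ B)
    (hv : ∀ t, 0 ≤ t → ∀ i, HasDerivWithinAt (fun s => v s i) (F (v t) i) (Ici 0) t)
    {a c : ℝ} (ha : 0 ≤ a) (hva : ∀ i, ‖v a i‖ ≤ R) (hc : B * c ≤ R' - R) :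
    ∀ t ∈ Icc a (a + c), ∀ i, ‖v t i‖ ≤ R' := fun t ht i => by
  have hB : 0 ≤ B := (norm_nonneg _).trans (hF (v a) i)
  have hdrift : ‖v t i - v a i‖ ≤ B * (t - a) :=
    norm_image_sub_le_of_norm_deriv_le_segment'
      (fun s hs => (hv s (ha.trans hs.1) i).mono fun x hx => ha.trans hx.1)
      (fun s _ => hF (v s) i) t ht
  have hBc : B * (t - a) ≤ B * c := by gcongr; exact sub_le_iff_le_add'.2 ht.2
  linarith [norm_sub_norm_le (v t i) (v a i), hva i]

lemma eqOn_Icc_of_forall_hasDerivWithinAt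
    (hF : ∀ x y, (∀ i, ‖x i‖ ≤ R) → (∀ i, ‖y i‖ ≤ R) → ∀ D, (∀ i, ‖x i - y i‖ ≤ D) →
      ∀ i, ‖F x i - F y i‖ ≤ L * D)
    (hu : ∀ t, 0 ≤ t → ∀ i, HasDerivWithinAt (fun s => u s i) (F (u t) i) (Ici 0) t)
    (hv : ∀ t, 0 ≤ t → ∀ i, HasDerivWithinAt (fun s => v s i) (F (v t) i) (Ici 0) t)
    {a c : ℝ} (ha : 0 ≤ a) (hc : L * c ≤ 1 / 2)
    (huR : ∀ t ∈ Icc a (a + c), ∀ i, ‖u t i‖ ≤ R) (hvR : ∀ t ∈ Icc a (a + c), ∀ i, ‖v t i‖ ≤ R)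
    (hva : v a = u a) : EqOn v u (Icc a (a + c)) := by
  let f : Icc a (a + c) × ι → ℝ := fun p => ‖v p.1 p.2 - u p.1 p.2‖
  have hbdd : BddAbove (range f) := ⟨R + R, by
    rintro _ ⟨⟨⟨t, ht⟩, i⟩, rfl⟩
    exact norm_sub_le_of_le (hvR t ht i) (huR t ht i)⟩
  have hhalf (D : ℝ) (hD : ∀ p, f p ≤ D) : ∀ p, f p ≤ D / 2 := by
    rintro ⟨⟨t, ht⟩, i⟩
    have hD₀ : 0 ≤ D := (norm_nonneg _).trans (hD ⟨⟨t, ht⟩, i⟩)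
    have hdrift := norm_image_sub_le_of_norm_deriv_le_segment'
      (fun s hs => ((hv s (ha.trans hs.1) i).sub (hu s (ha.trans hs.1) i)).mono
        fun x hx => ha.trans hx.1)
      (fun s hs => hF _ _ (hvR s (Ico_subset_Icc_self hs)) (huR s (Ico_subset_Icc_self hs)) D
        (fun j => hD ⟨⟨s, Ico_subset_Icc_self hs⟩, j⟩) i) t ht
    calc ‖v t i - u t i‖ ≤ L * D * (t - a) := by simpa [hva] using hdrift
      _ ≤ L * D * c := by gcongr; exact sub_le_iff_le_add'.2 ht.2
      _ = L * c * D := by ring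
      _ ≤ 1 / 2 * D := by gcongr
      _ = D / 2 := by ring
  exact fun t ht => funext fun i => sub_eq_zero.1 <| norm_le_zero_iff.1 <|
    nonpos_of_forall_le_imp_le_half hbdd hhalf ⟨⟨t, ht⟩, i⟩

lemma eqOn_Ici_of_forall_hasDerivWithinAt (hRR' : R < R') (hB : ∀ x i, ‖F x i‖ ≤ B)
    (hF : ∀ x y, (∀ i, ‖x i‖ ≤ R') → (∀ i, ‖y i‖ ≤ R') → ∀ D, (∀ i, ‖x i - y i‖ ≤ D) →
      ∀ i, ‖F x i - F y i‖ ≤ L * D)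
    (hu : ∀ t, 0 ≤ t → ∀ i, HasDerivWithinAt (fun s => u s i) (F (u t) i) (Ici 0) t)
    (hv : ∀ t, 0 ≤ t → ∀ i, HasDerivWithinAt (fun s => v s i) (F (v t) i) (Ici 0) t)
    (huR : ∀ t, 0 ≤ t → ∀ i, ‖u t i‖ ≤ R) (h₀ : v 0 = u 0) : EqOn v u (Ici 0) := by
  obtain ⟨c, hc, hcmin⟩ :=
    exists_pos_mul_lt (lt_min (sub_pos.2 hRR') (one_half_pos (α := ℝ))) (max B L)
  have hBc : B * c ≤ R' - R :=
    (mul_le_mul_of_nonneg_right (le_max_left _ _) hc.le).trans (hcmin.le.trans (min_le_left _ _))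
  have hLc : L * c ≤ 1 / 2 :=
    (mul_le_mul_of_nonneg_right (le_max_right _ _) hc.le).trans (hcmin.le.trans (min_le_right _ _))
  refine fun t ht => forall_nonneg_of_forall_mem_Icc_add (P := fun t => v t = u t) hc h₀
    (fun a ha hva => ?_) ht
  exact eqOn_Icc_of_forall_hasDerivWithinAt hF hu hv ha hLc
    (fun s hs i => (huR s (ha.trans hs.1) i).trans hRR'.le)
    (norm_apply_le_of_hasDerivWithinAt_Ici hB hv ha (fun i => hva ▸ huR a ha i) hBc) hva

end CoordinatewiseUniqueness

section PointwiseBounds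

variable {ι κ : Type*} {E F : ι → Type*} [∀ i, NormedAddCommGroup (E i)]
  [∀ i, NormedAddCommGroup (F i)] {p : ℝ≥0∞} {g : κ → lp F p} {s : Finset κ} {C : ℝ}

lemma memℓp_const_mul_sum_norm (g : κ → lp F p) (s : Finset κ) (C : ℝ) :
    Memℓp (fun i => C * ∑ m ∈ s, ‖g m i‖) p :=
  (Memℓp.finsetSum s fun m _ => (lp.memℓp (g m)).norm).const_mul C

lemma memℓp_of_norm_le_mul_sum {f : ∀ i, E i} (hf : ∀ i, ‖f i‖ ≤ C * ∑ m ∈ s, ‖g m i‖) :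
    Memℓp f p :=
  (memℓp_const_mul_sum_norm g s C).mono hf

lemma lp_norm_le_mul_sum [Fact (1 ≤ p)] {f : lp E p} (hC : 0 ≤ C)
    (hf : ∀ i, ‖f i‖ ≤ C * ∑ m ∈ s, ‖g m i‖) : ‖f‖ ≤ C * ∑ m ∈ s, ‖g m‖ := by
  have hp : p ≠ 0 := (zero_lt_one.trans_le Fact.out).ne'
  let h (m : κ) : lp (fun _ : ι => ℝ) p := ⟨fun i => ‖g m i‖, (lp.memℓp (g m)).norm⟩
  have hh (m : κ) : ‖h m‖ ≤ ‖g m‖ := lp.norm_mono hp fun i => (norm_norm _).le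
  have hfh : ‖f‖ ≤ ‖C • ∑ m ∈ s, h m‖ := lp.norm_mono hp fun i => (hf i).trans <| by
    rw [lp.coeFn_smul, lp.coeFn_sum, Pi.smul_apply, Finset.sum_apply, smul_eq_mul]
    exact Real.le_norm_self _
  calc ‖f‖ ≤ C * ‖∑ m ∈ s, h m‖ := hfh.trans_eq (by rw [norm_smul, Real.norm_of_nonneg hC])
    _ ≤ C * ∑ m ∈ s, ‖g m‖ := by gcongr; exact norm_sum_le_of_le s fun m _ => hh m

end PointwiseBounds

section SquareSummable

lemma hasSum_sq_lp_two {ι : Type*} (u : ℓ²(ι, ℝ)) : HasSum (fun i => u i ^ 2) (‖u‖ ^ 2) := by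
  simpa only [real_inner_self_eq_norm_sq, Real.norm_eq_abs, sq_abs] using
    lp.hasSum_inner (𝕜 := ℝ) u u

lemma sum_comp_norm_mul_norm_le_lp_two {ι κ : Type*} (u v : ℓ²(ι, ℝ)) {e : κ → ι}
    (he : Function.Injective e) (s : Finset κ) : ∑ k ∈ s, ‖u (e k)‖ * ‖v (e k)‖ ≤ ‖u‖ * ‖v‖ := by
  obtain ⟨hsum, hle⟩ := lp.tsum_mul_le_mul_norm
    (show ((2 : ℝ≥0∞).toReal).HolderConjugate (2 : ℝ≥0∞).toReal by
      rw [Real.holderConjugate_iff]; norm_num) u v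
  calc ∑ k ∈ s, ‖u (e k)‖ * ‖v (e k)‖ = ∑ i ∈ s.map ⟨e, he⟩, ‖u i‖ * ‖v i‖ := by simp
    _ ≤ ∑' i, ‖u i‖ * ‖v i‖ := hsum.sum_le_tsum _ fun i _ => by positivity
    _ ≤ ‖u‖ * ‖v‖ := hle

variable {A : Type*} [AddCommGroup A]

lemma memℓp_two_comp_add_right (d : A) (u : ℓ²(A, ℝ)) : Memℓp (fun i => u (i + d)) 2 :=
  (memℓp_gen_iff (by norm_num)).2 <|
    ((lp.memℓp u).summable (by norm_num)).comp_injective (add_left_injective d)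

/-- The translation `u ↦ u (· + d)` as a linear isometry of `ℓ²(A, ℝ)`. -/
noncomputable def l2Translate (d : A) : ℓ²(A, ℝ) →ₗᵢ[ℝ] ℓ²(A, ℝ) where
  toFun u := ⟨fun i => u (i + d), memℓp_two_comp_add_right d u⟩
  map_add' _ _ := rfl
  map_smul' _ _ := rfl
  norm_map' u := by
    have hshift : HasSum (fun i => u (i + d) ^ 2) (‖u‖ ^ 2) :=
      (Equiv.addRight d).hasSum_iff (f := fun i => u i ^ 2).2 (hasSum_sq_lp_two u)
    exact (sq_eq_sq₀ (norm_nonneg _) (norm_nonneg _)).1 ((hasSum_sq_lp_two _).unique hshift)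

/-- The forward difference operator `Δ_[d]` as a bounded operator on `ℓ²(A, ℝ)`. -/
noncomputable def l2FwdDiff (d : A) : ℓ²(A, ℝ) →L[ℝ] ℓ²(A, ℝ) :=
  (l2Translate d).toContinuousLinearMap - .id ℝ _

lemma coe_l2FwdDiff (d : A) (u : ℓ²(A, ℝ)) : ⇑(l2FwdDiff d u) = Δ_[d] ⇑u := rfl

lemma norm_l2FwdDiff_le (d : A) (u : ℓ²(A, ℝ)) : ‖l2FwdDiff d u‖ ≤ 2 * ‖u‖ :=
  (norm_sub_le (l2Translate d u) u).trans_eq (by rw [LinearIsometry.norm_map, two_mul])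

lemma inner_l2FwdDiff_self (d : A) (u : ℓ²(A, ℝ)) :
    ⟪u, l2FwdDiff d u⟫ = -(1 / 2) * ‖l2FwdDiff d u‖ ^ 2 := by
  have hexp := norm_add_sq_real u (l2FwdDiff d u)
  have hadd : u + l2FwdDiff d u = l2Translate d u := add_sub_cancel u _
  rw [hadd, LinearIsometry.norm_map] at hexp
  linarith

lemma sq_apply_le_norm_l2FwdDiff_mul_norm {d : A}
    (hd : Function.Injective fun k : ℕ => k • d) (u : ℓ²(A, ℝ)) (i : A) :
    u i ^ 2 ≤ 2 * ‖l2FwdDiff d u‖ * ‖u‖ := by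
  have hinj : Function.Injective fun k : ℕ => i + k • d := (add_right_injective i).comp hd
  have htail : Tendsto (fun n : ℕ => u (i + n • d) ^ 2) atTop (𝓝 0) :=
    ((hasSum_sq_lp_two u).summable.comp_injective hinj).tendsto_atTop_zero
  have hterm (j : A) : u j ^ 2 - u (j + d) ^ 2 ≤
      ‖l2FwdDiff d u j‖ * ‖u j‖ + ‖l2FwdDiff d u j‖ * ‖l2Translate d u j‖ :=
    calc u j ^ 2 - u (j + d) ^ 2 = -(l2FwdDiff d u j * (u j + l2Translate d u j)) := by
          change _ = -((u (j + d) - u j) * (u j + u (j + d)))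
          ring
      _ ≤ ‖l2FwdDiff d u j‖ * ‖u j + l2Translate d u j‖ :=
          (neg_le_abs _).trans_eq (abs_mul _ _)
      _ ≤ _ := by rw [← mul_add]; gcongr; exact norm_add_le _ _
  have htelescope (n : ℕ) : u i ^ 2 - u (i + n • d) ^ 2 ≤ 2 * ‖l2FwdDiff d u‖ * ‖u‖ := by
    have hsum := Finset.sum_le_sum fun k (_ : k ∈ Finset.range n) => hterm (i + k • d)
    simp only [add_assoc, ← succ_nsmul] at hsum
    rw [Finset.sum_range_sub' (fun k => u (i + k • d) ^ 2), zero_nsmul, add_zero,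
      Finset.sum_add_distrib] at hsum
    have hu := sum_comp_norm_mul_norm_le_lp_two (l2FwdDiff d u) u hinj (Finset.range n)
    have hTu :=
      sum_comp_norm_mul_norm_le_lp_two (l2FwdDiff d u) (l2Translate d u) hinj (Finset.range n)
    rw [LinearIsometry.norm_map] at hTu
    linarith
  exact le_of_tendsto' (by simpa using htail.const_sub (u i ^ 2)) htelescope

lemma tendstoUniformly_zero_of_tendsto_l2FwdDiff {d : A}
    (hd : Function.Injective fun k : ℕ => k • d) {T : Type*} {l : Filter T} {u : T → ℓ²(A, ℝ)}
    {R : ℝ} (hR : ∀ᶠ t in l, ‖u t‖ ≤ R) (hu : Tendsto (fun t => l2FwdDiff d (u t)) l (𝓝 0)) :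
    TendstoUniformly (fun t => ⇑(u t)) (fun _ => 0) l := by
  refine Metric.tendstoUniformly_iff.2 fun ε hε => ?_
  have hbound : Tendsto (fun t => 2 * ‖l2FwdDiff d (u t)‖ * R) l (𝓝 0) := by
    simpa using (hu.norm.const_mul 2).mul_const R
  filter_upwards [hR, hbound.eventually_lt_const (pow_pos hε 2)] with t hRt hεt i
  rw [dist_zero_left]
  refine abs_lt_of_sq_lt_sq (lt_of_le_of_lt ?_ hεt) hε.le
  exact (sq_apply_le_norm_l2FwdDiff_mul_norm hd (u t) i).trans (by gcongr)

end SquareSummable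

section CornerAngle

/-- The angle at `i` of the triangle `ijk` in the metric `u ∗ d_reg`, as a function of the pair
`(u_j - u_i, u_k - u_i)`: the law of cosines in these coordinates. -/
noncomputable def cornerAngle (z : ℝ × ℝ) : ℝ :=
  Real.arccos (Real.cosh ((z.1 - z.2) / 2) - Real.exp ((z.1 + z.2) / 2) / 2)

lemma cornerAngle_swap (z : ℝ × ℝ) : cornerAngle z.swap = cornerAngle z := by
  rw [cornerAngle, cornerAngle, Prod.fst_swap, Prod.snd_swap, add_comm, ← Real.cosh_neg,
    ← neg_div, neg_sub]

lemma cornerAngle_zero : cornerAngle 0 = Real.pi / 3 := by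
  rw [cornerAngle, ← Real.arccos_cos (by positivity : 0 ≤ Real.pi / 3) (by linarith [Real.pi_pos]),
    Real.cos_pi_div_three]
  norm_num

lemma innerAngle_conformalChange_regularMetric (u : HexVertex → ℝ) (i j k : HexVertex) :
    innerAngle (conformalChange u regularMetric) i j k = cornerAngle (u j - u i, u k - u i) := by
  simp only [innerAngle, cornerAngle, conformalChange, regularMetric, Real.cosh_eq,
    sub_eq_add_neg, neg_add, neg_neg, add_div, neg_div, Real.exp_add, Real.exp_neg]
  congr 1
  field_simp

lemma hasFDerivAt_cornerAngle_zero :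
    HasFDerivAt cornerAngle
      ((2 * √3)⁻¹ • (ContinuousLinearMap.fst ℝ ℝ ℝ + ContinuousLinearMap.snd ℝ ℝ ℝ)) 0 := by
  have hcos : HasFDerivAt
      (fun z : ℝ × ℝ => Real.cosh ((z.1 - z.2) * 2⁻¹) - Real.exp ((z.1 + z.2) * 2⁻¹) * 2⁻¹)
      ((-(1 / 4) : ℝ) • (ContinuousLinearMap.fst ℝ ℝ ℝ + ContinuousLinearMap.snd ℝ ℝ ℝ)) 0 := by
    refine (((hasFDerivAt_fst.fun_sub hasFDerivAt_snd).mul_const 2⁻¹).cosh.fun_sub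
      (((hasFDerivAt_fst.fun_add hasFDerivAt_snd).mul_const 2⁻¹).exp.mul_const 2⁻¹)).congr_fderiv ?_
    ext <;> norm_num
  have harccos : HasDerivAt Real.arccos (-(2 / √3)) (1 / 2) := by
    refine (Real.hasDerivAt_arccos (by norm_num) (by norm_num)).congr_deriv ?_
    rw [show 1 - (1 / 2 : ℝ) ^ 2 = 3 / 2 ^ 2 by norm_num, Real.sqrt_div' _ (by positivity),
      Real.sqrt_sq two_pos.le, one_div_div]
  have hcomp := harccos.comp_hasFDerivAt_of_eq 0 hcos (by norm_num)
  simp only [Function.comp_def, ← div_eq_mul_inv] at hcomp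
  refine hcomp.congr_fderiv ?_
  rw [smul_smul]
  congr 1
  field_simp
  norm_num

lemma contDiffAt_cornerAngle_zero {n : WithTop ℕ∞} : ContDiffAt ℝ n cornerAngle 0 := by
  have hcos : ContDiffAt ℝ n (fun z : ℝ × ℝ =>
      Real.cosh ((z.1 - z.2) / 2) - Real.exp ((z.1 + z.2) / 2) / 2) 0 := by fun_prop
  exact (Real.contDiffAt_arccos (by norm_num) (by norm_num)).comp 0 hcos

/-- `cornerAngle` is `K`-Lipschitz on the ball of radius `r` about the origin, and agrees there
with its linearization at the origin up to an error `K ‖z‖²`. -/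
structure CornerAngleEstimate (K : ℝ≥0) (r : ℝ) : Prop where
  radius_pos : 0 < r
  lipschitzOnWith : LipschitzOnWith K cornerAngle (closedBall 0 r)
  linearization : ∀ z ∈ closedBall 0 r,
    |cornerAngle z - Real.pi / 3 - (z.1 + z.2) / (2 * √3)| ≤ K * ‖z‖ ^ 2

lemma exists_cornerAngleEstimate : ∃ K r, CornerAngleEstimate K r := by
  obtain ⟨K₁, s, hs, hlip⟩ := (contDiffAt_cornerAngle_zero (n := 1)).exists_lipschitzOnWith
  obtain ⟨K₂, hK₂⟩ := (isBigO_sub_fderiv_sq_of_contDiffAt contDiffAt_cornerAngle_zero).bound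
  obtain ⟨r, hr, hrs⟩ := nhds_basis_closedBall.mem_iff.1 (inter_mem hs hK₂)
  refine ⟨max K₁ K₂.toNNReal, r, hr, ?_, fun z hz => ?_⟩
  · exact (hlip.mono fun z hz => (hrs hz).1).weaken (le_max_left _ _)
  · have hz₂ := (hrs hz).2
    simp only [mem_ofPred_eq, sub_zero, cornerAngle_zero, hasFDerivAt_cornerAngle_zero.fderiv,
      norm_pow, norm_norm] at hz₂
    refine le_trans (le_of_eq_of_le ?_ hz₂) ?_
    · simp [div_eq_inv_mul, mul_add]
    · gcongr
      exact K₂.le_coe_toNNReal.trans (by exact_mod_cast le_max_right K₁ K₂.toNNReal)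

end CornerAngle

section HexagonalLattice

/-- The six unit vectors of the lattice in counterclockwise order; `hexDir m` is the direction
`ω ^ m`. -/
def hexDir : Fin 6 → HexVertex := ![(1, 0), (0, 1), (-1, 1), (-1, 0), (0, -1), (1, -1)]

lemma hexDir_add_hexDir_add_two : ∀ m, hexDir m + hexDir (m + 2) = hexDir (m + 1) := by decide

lemma hexDir_add_hexDir_eq_of_add_eq_zero : ∀ m n p, hexDir m + hexDir n + hexDir p = 0 →
    hexDir m + hexDir n = hexDir (m + 1) ∨ hexDir m + hexDir n = hexDir (m - 1) := by
  decide

lemma injective_nsmul_hexDir_zero : Function.Injective fun k : ℕ => k • hexDir 0 := fun k l h => by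
  simpa [hexDir] using h

lemma hexGraph_adj_iff {i j : HexVertex} : hexGraph.Adj i j ↔ ∃ m, j = i + hexDir m := by
  simp [hexGraph, Fin.exists_fin_succ, hexDir, ← sub_eq_iff_eq_add']

lemma hexGraph_adj_add_hexDir (i : HexVertex) (m : Fin 6) : hexGraph.Adj i (i + hexDir m) :=
  hexGraph_adj_iff.2 ⟨m, rfl⟩

lemma isHexFace_swap {i j k : HexVertex} (h : IsHexFace i j k) : IsHexFace i k j :=
  ⟨h.2.2.symm, h.2.1.symm, h.1.symm⟩

lemma isHexFace_add_hexDir (i : HexVertex) (m : Fin 6) :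
    IsHexFace i (i + hexDir m) (i + hexDir (m + 1)) := by
  refine ⟨hexGraph_adj_add_hexDir i m, ?_, (hexGraph_adj_add_hexDir i (m + 1)).symm⟩
  rw [← hexDir_add_hexDir_add_two, ← add_assoc]
  exact hexGraph_adj_add_hexDir _ _

/-- The faces at `i` as ordered pairs of vertices: `inl m` is the face spanned by the directions
`m` and `m + 1`, and `inr m` is the same face with the opposite orientation. -/
def hexFaceAt (i : HexVertex) : Fin 6 ⊕ Fin 6 → HexVertex × HexVertex :=
  Sum.elim (fun m => (i + hexDir m, i + hexDir (m + 1)))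
    fun m => (i + hexDir (m + 1), i + hexDir m)

lemma hexFaceAt_injective (i : HexVertex) : Function.Injective (hexFaceAt i) := by
  have hzero : Function.Injective (hexFaceAt 0) := by decide
  have htranslate (x) : hexFaceAt i x = (i, i) + hexFaceAt 0 x := by
    cases x <;> simp [hexFaceAt]
  exact fun x y hxy => hzero <| add_left_cancel (a := (i, i)) <| by
    rw [← htranslate, ← htranslate, hxy]

lemma range_hexFaceAt (i : HexVertex) :
    range (hexFaceAt i) = {p | IsHexFace i p.1 p.2} := by
  ext ⟨j, k⟩
  constructor
  · rintro ⟨m | m, hm⟩ <;> obtain ⟨rfl, rfl⟩ := Prod.ext_iff.1 hm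
    · exact isHexFace_add_hexDir i m
    · exact isHexFace_swap (isHexFace_add_hexDir i m)
  · rintro ⟨hij, hjk, hki⟩
    dsimp only at hij hjk hki
    obtain ⟨m, rfl⟩ := hexGraph_adj_iff.1 hij
    obtain ⟨n, rfl⟩ := hexGraph_adj_iff.1 hjk
    obtain ⟨p, hp⟩ := hexGraph_adj_iff.1 hki
    rw [add_assoc, add_assoc, left_eq_add, ← add_assoc] at hp
    rcases hexDir_add_hexDir_eq_of_add_eq_zero m n p hp with h | h
    · exact ⟨.inl m, by simp [hexFaceAt, add_assoc, h]⟩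
    · exact ⟨.inr (m - 1), by simp [hexFaceAt, add_assoc, h]⟩

/-- The pair of differences `(u_j - u_i, u_k - u_i)` over the face `ijk` spanned by the directions
`m` and `m + 1` at `i`. -/
def cornerDiff (u : HexVertex → ℝ) (i : HexVertex) (m : Fin 6) : ℝ × ℝ :=
  (Δ_[hexDir m] u i, Δ_[hexDir (m + 1)] u i)

/-- The right-hand side `-K_i(u ∗ d_reg)` of the flow, written through the deviations of the six
angles at `i` from `π / 3`. -/
noncomputable def flowField (u : HexVertex → ℝ) (i : HexVertex) : ℝ :=
  ∑ m, (cornerAngle (cornerDiff u i m) - Real.pi / 3)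

lemma neg_discreteCurvature_conformalChange_regularMetric (u : HexVertex → ℝ) (i : HexVertex) :
    -discreteCurvature (conformalChange u regularMetric) i = flowField u i := by
  have hswap (m : Fin 6) : cornerAngle (u (i + hexDir (m + 1)) - u i, u (i + hexDir m) - u i) =
      cornerAngle (cornerDiff u i m) := (cornerAngle_swap _).symm
  rw [discreteCurvature, ← range_hexFaceAt, finsum_mem_range (hexFaceAt_injective i),
    finsum_eq_sum_of_fintype, Fintype.sum_sum_type]
  simp only [hexFaceAt, Sum.elim_inl, Sum.elim_inr, innerAngle_conformalChange_regularMetric,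
    hswap, flowField, Finset.sum_sub_distrib, cornerDiff, fwdDiff, Finset.sum_const,
    Finset.card_univ, Fintype.card_fin, nsmul_eq_mul]
  ring

lemma norm_flowField_le (u : HexVertex → ℝ) (i : HexVertex) : ‖flowField u i‖ ≤ 6 * Real.pi := by
  have hcorner (z : ℝ × ℝ) : ‖cornerAngle z - Real.pi / 3‖ ≤ Real.pi := by
    have h₀ : 0 ≤ cornerAngle z := Real.arccos_nonneg _
    have hπ : cornerAngle z ≤ Real.pi := Real.arccos_le_pi _
    exact abs_le.2 ⟨by linarith, by linarith⟩
  exact (norm_sum_le_of_le Finset.univ fun m _ => hcorner (cornerDiff u i m)).trans_eq (by simp)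

lemma flowField_zero : flowField 0 = 0 :=
  funext fun i => Finset.sum_eq_zero fun m _ => sub_eq_zero.2 <| by
    rw [← cornerAngle_zero]
    congr
    simp [cornerDiff, fwdDiff]

lemma isPLMetric_conformalChange_regularMetric {u : HexVertex → ℝ} (hu : ∀ i, ‖u i‖ ≤ 1 / 4) :
    IsPLMetric (conformalChange u regularMetric) where
  symm i j _ := by simp [conformalChange, regularMetric, add_comm]
  pos i j _ := by simp [conformalChange, regularMetric, Real.exp_pos]
  triangle i j k _ := by
    simp only [conformalChange, regularMetric, mul_one]
    have hi := abs_le.1 (hu i)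
    have hj := abs_le.1 (hu j)
    have hk := abs_le.1 (hu k)
    have hij : Real.exp ((u i + u j) / 2) ≤ Real.exp (1 / 4) := Real.exp_le_exp.2 (by linarith)
    have hquarter : Real.exp (1 / 4) < 3 / 2 :=
      (Real.exp_bound_div_one_sub_of_interval (by norm_num) (by norm_num)).trans_lt (by norm_num)
    linarith [Real.add_one_le_exp ((u i + u k) / 2), Real.add_one_le_exp ((u k + u j) / 2)]

lemma tendstoUniformly_conformalChange_regularMetric {T : Type*} {l : Filter T}
    {u : T → HexVertex → ℝ} (hu : TendstoUniformly u (fun _ => 0) l) :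
    TendstoUniformly (fun t (p : HexVertex × HexVertex) =>
      conformalChange (u t) regularMetric p.1 p.2) (fun p => regularMetric p.1 p.2) l := by
  have hcomp (f : HexVertex × HexVertex → HexVertex) :
      Tendsto (fun q : T × HexVertex × HexVertex => u q.1 (f q.2)) (l ×ˢ ⊤) (𝓝 0) :=
    (tendsto_prod_top_iff.2 hu).comp (tendsto_id.prodMap tendsto_top)
  have hexp := (((hcomp Prod.fst).add (hcomp Prod.snd)).div_const 2).rexp.mul_const 1
  rw [add_zero, zero_div, Real.exp_zero, mul_one] at hexp
  exact tendsto_prod_top_iff.1 hexp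

end HexagonalLattice

section DirichletEnergy

lemma edgeDiffSq_nonneg (u : HexVertex → ℝ) (e : Sym2 HexVertex) : 0 ≤ edgeDiffSq u e := by
  induction e with
  | h i j => exact sq_nonneg _

/-- The edge that leaves `i` in the direction `m`. Every edge arises twice, once from each
endpoint. -/
def hexEdge (p : Fin 6 × HexVertex) : hexGraph.edgeSet :=
  ⟨s(p.2, p.2 + hexDir p.1), hexGraph_adj_add_hexDir p.2 p.1⟩

lemma hexEdge_surjective : Function.Surjective hexEdge := by
  rintro ⟨e, he⟩
  induction e with
  | h i j =>
    rw [SimpleGraph.mem_edgeSet] at he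
    obtain ⟨m, rfl⟩ := hexGraph_adj_iff.1 he
    exact ⟨(m, i), rfl⟩

lemma edgeDiffSq_hexEdge (u : HexVertex → ℝ) (p : Fin 6 × HexVertex) :
    edgeDiffSq u (hexEdge p) = (Δ_[hexDir p.1] u p.2) ^ 2 := by
  change |u p.2 - u (p.2 + hexDir p.1)| ^ 2 = (u (p.2 + hexDir p.1) - u p.2) ^ 2
  rw [abs_sub_comm, sq_abs]

lemma hasSum_edgeDiffSq_hexEdge (u : ℓ²(HexVertex, ℝ)) :
    HasSum (fun p => edgeDiffSq u (hexEdge p)) (∑ m, ‖l2FwdDiff (hexDir m) u‖ ^ 2) := by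
  have hdir (m : Fin 6) : HasSum (fun i => edgeDiffSq u (hexEdge (m, i)))
      (‖l2FwdDiff (hexDir m) u‖ ^ 2) := by
    simpa only [edgeDiffSq_hexEdge, coe_l2FwdDiff] using hasSum_sq_lp_two (l2FwdDiff (hexDir m) u)
  have hsum : Summable fun p => edgeDiffSq u (hexEdge p) :=
    (summable_prod_of_nonneg fun _ => edgeDiffSq_nonneg _ _).2
      ⟨fun m => (hdir m).summable, (hasSum_fintype _).summable⟩
  simpa only [hsum.tsum_prod, (hdir _).tsum_eq, tsum_fintype] using hsum.hasSum

lemma summable_edgeDiffSq (u : ℓ²(HexVertex, ℝ)) :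
    Summable fun e : hexGraph.edgeSet => edgeDiffSq u e := by
  simpa only [Function.comp_def, Function.surjInv_eq] using
    (hasSum_edgeDiffSq_hexEdge u).summable.comp_injective
      (Function.injective_surjInv hexEdge_surjective)

lemma dirichletEnergy_le (u : ℓ²(HexVertex, ℝ)) :
    dirichletEnergy u ≤ ∑ m, ‖l2FwdDiff (hexDir m) u‖ ^ 2 := by
  rw [dirichletEnergy, ← (hasSum_edgeDiffSq_hexEdge u).tsum_eq]
  simpa only [Function.comp_def, Function.surjInv_eq] using
    tsum_comp_le_tsum_of_inj (hasSum_edgeDiffSq_hexEdge u).summable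
      (fun _ => edgeDiffSq_nonneg _ _) (Function.injective_surjInv hexEdge_surjective)

lemma tendsto_dirichletEnergy_zero {T : Type*} {l : Filter T} {u : T → ℓ²(HexVertex, ℝ)}
    (hu : ∀ m, Tendsto (fun t => l2FwdDiff (hexDir m) (u t)) l (𝓝 0)) :
    Tendsto (fun t => dirichletEnergy (u t)) l (𝓝 0) := by
  refine squeeze_zero (fun t => tsum_nonneg fun e => edgeDiffSq_nonneg _ e)
    (fun t => dirichletEnergy_le (u t)) ?_
  simpa using tendsto_finsetSum Finset.univ fun m _ => (hu m).norm.pow 2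

end DirichletEnergy

section FlowEstimates

variable {u v : HexVertex → ℝ} {K : ℝ≥0} {r D ρ : ℝ}

lemma sum_hexDir_add_one {M : Type*} [AddCommMonoid M] (f : HexVertex → M) :
    ∑ m, f (hexDir (m + 1)) = ∑ m, f (hexDir m) :=
  Fintype.sum_equiv (Equiv.addRight 1) _ _ fun _ => rfl

lemma cornerDiff_sub (u v : HexVertex → ℝ) (i : HexVertex) (m : Fin 6) :
    cornerDiff u i m - cornerDiff v i m = cornerDiff (u - v) i m :=
  Prod.ext (sub_sub_sub_comm _ _ _ _) (sub_sub_sub_comm _ _ _ _)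

lemma norm_fwdDiff_le (hu : ∀ i, ‖u i‖ ≤ D) (d i : HexVertex) : ‖Δ_[d] u i‖ ≤ 2 * D :=
  (norm_sub_le _ _).trans (by linarith [hu i, hu (i + d)])

lemma cornerDiff_mem_closedBall (hu : ∀ i, ‖u i‖ ≤ r / 2) (i : HexVertex) (m : Fin 6) :
    cornerDiff u i m ∈ closedBall 0 r := by
  have hdiff (d : HexVertex) : ‖Δ_[d] u i‖ ≤ r := (norm_fwdDiff_le hu d i).trans_eq (by ring)
  exact mem_closedBall_zero_iff.2 (max_le (hdiff _) (hdiff _))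

lemma sum_norm_cornerDiff_pow_le (u : HexVertex → ℝ) (i : HexVertex) (n : ℕ) :
    ∑ m, ‖cornerDiff u i m‖ ^ n ≤ 2 * ∑ m, ‖Δ_[hexDir m] u i‖ ^ n := by
  have hcorner (m : Fin 6) : ‖cornerDiff u i m‖ ^ n ≤
      ‖Δ_[hexDir m] u i‖ ^ n + ‖Δ_[hexDir (m + 1)] u i‖ ^ n := by
    rcases max_choice ‖Δ_[hexDir m] u i‖ ‖Δ_[hexDir (m + 1)] u i‖ with h | h
    · exact (congrArg (· ^ n) h).trans_le (le_add_of_nonneg_right (by positivity))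
    · exact (congrArg (· ^ n) h).trans_le (le_add_of_nonneg_left (by positivity))
  refine (Finset.sum_le_sum fun m _ => hcorner m).trans_eq ?_
  rw [Finset.sum_add_distrib, sum_hexDir_add_one (fun d => ‖Δ_[d] u i‖ ^ n), two_mul]

namespace CornerAngleEstimate

lemma norm_flowField_sub_le (hK : CornerAngleEstimate K r) (hu : ∀ i, ‖u i‖ ≤ r / 2)
    (hv : ∀ i, ‖v i‖ ≤ r / 2) (i : HexVertex) :
    ‖flowField u i - flowField v i‖ ≤ 2 * K * ∑ m, ‖Δ_[hexDir m] (u - v) i‖ :=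
  calc ‖flowField u i - flowField v i‖
      = ‖∑ m, (cornerAngle (cornerDiff u i m) - cornerAngle (cornerDiff v i m))‖ := by
        simp only [flowField, ← Finset.sum_sub_distrib, sub_sub_sub_cancel_right]
    _ ≤ ∑ m, K * ‖cornerDiff (u - v) i m‖ := norm_sum_le_of_le _ fun m _ => by
        rw [← cornerDiff_sub]
        exact hK.lipschitzOnWith.norm_sub_le (cornerDiff_mem_closedBall hu i m)
          (cornerDiff_mem_closedBall hv i m)
    _ ≤ K * (2 * ∑ m, ‖Δ_[hexDir m] (u - v) i‖) := by
        rw [← Finset.mul_sum]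
        gcongr
        simpa only [pow_one] using sum_norm_cornerDiff_pow_le (u - v) i 1
    _ = 2 * K * ∑ m, ‖Δ_[hexDir m] (u - v) i‖ := by ring

lemma norm_flowField_sub_le_of_norm_sub_le (hK : CornerAngleEstimate K r)
    (hu : ∀ i, ‖u i‖ ≤ r / 2) (hv : ∀ i, ‖v i‖ ≤ r / 2) (hD : ∀ i, ‖u i - v i‖ ≤ D)
    (i : HexVertex) : ‖flowField u i - flowField v i‖ ≤ 24 * K * D :=
  calc ‖flowField u i - flowField v i‖ ≤ 2 * K * ∑ m, ‖Δ_[hexDir m] (u - v) i‖ :=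
        hK.norm_flowField_sub_le hu hv i
    _ ≤ 2 * K * ∑ _m : Fin 6, 2 * D := by gcongr; exact norm_fwdDiff_le hD _ i
    _ = 24 * K * D := by
        simp only [Finset.sum_const, Finset.card_univ, Fintype.card_fin, nsmul_eq_mul]
        ring

lemma norm_flowField_le_mul_sum (hK : CornerAngleEstimate K r) (hu : ∀ i, ‖u i‖ ≤ r / 2)
    (i : HexVertex) : ‖flowField u i‖ ≤ 2 * K * ∑ m, ‖Δ_[hexDir m] u i‖ := by
  have h₀ (j : HexVertex) : ‖(0 : HexVertex → ℝ) j‖ ≤ r / 2 := by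
    simpa using (half_pos hK.radius_pos).le
  simpa only [flowField_zero, Pi.zero_apply, sub_zero] using hK.norm_flowField_sub_le hu h₀ i

lemma norm_flowField_sub_linearization_le (hK : CornerAngleEstimate K r)
    (hu : ∀ i, ‖u i‖ ≤ r / 2) (i : HexVertex) :
    ‖flowField u i - (√3)⁻¹ * ∑ m, Δ_[hexDir m] u i‖ ≤
      2 * K * ∑ m, (Δ_[hexDir m] u i) ^ 2 := by
  have hlin : ∑ m, ((cornerDiff u i m).1 + (cornerDiff u i m).2) / (2 * √3) =
      (√3)⁻¹ * ∑ m, Δ_[hexDir m] u i := by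
    simp only [cornerDiff]
    rw [← Finset.sum_div, Finset.sum_add_distrib, sum_hexDir_add_one fun d => Δ_[d] u i]
    field_simp
    ring
  calc ‖flowField u i - (√3)⁻¹ * ∑ m, Δ_[hexDir m] u i‖
      ≤ ∑ m, K * ‖cornerDiff u i m‖ ^ 2 := by
        rw [← hlin, flowField, ← Finset.sum_sub_distrib]
        exact norm_sum_le_of_le _ fun m _ =>
          hK.linearization _ (cornerDiff_mem_closedBall hu i m)
    _ ≤ K * (2 * ∑ m, (Δ_[hexDir m] u i) ^ 2) := by
        rw [← Finset.mul_sum]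
        gcongr
        simpa only [Real.norm_eq_abs, sq_abs] using sum_norm_cornerDiff_pow_le u i 2
    _ = 2 * K * ∑ m, (Δ_[hexDir m] u i) ^ 2 := by ring

lemma mul_flowField_le (hK : CornerAngleEstimate K r) (hu : ∀ i, ‖u i‖ ≤ r / 2) (i : HexVertex)
    (hρ : ‖u i‖ ≤ ρ) : u i * flowField u i ≤
      (√3)⁻¹ * ∑ m, u i * Δ_[hexDir m] u i + 2 * K * ρ * ∑ m, (Δ_[hexDir m] u i) ^ 2 := by
  have herr : u i * (flowField u i - (√3)⁻¹ * ∑ m, Δ_[hexDir m] u i) ≤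
      ρ * (2 * K * ∑ m, (Δ_[hexDir m] u i) ^ 2) :=
    calc _ ≤ ‖u i‖ * ‖flowField u i - (√3)⁻¹ * ∑ m, Δ_[hexDir m] u i‖ :=
          (Real.le_norm_self _).trans_eq (norm_mul _ _)
      _ ≤ _ := by
          gcongr
          · exact (norm_nonneg _).trans hρ
          · exact hK.norm_flowField_sub_linearization_le hu i
  rw [← Finset.mul_sum]
  linarith

end CornerAngleEstimate

end FlowEstimates

section FlowOnL2

variable {K : ℝ≥0} {r ρ : ℝ} {u : ℓ²(HexVertex, ℝ)}

open Classical in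
/-- The right-hand side of the flow as a vector field on `ℓ²`. Its value is the junk `0` where
`flowField u` is not square summable, which does not happen for `u` near the origin. -/
noncomputable def l2FlowField (u : ℓ²(HexVertex, ℝ)) : ℓ²(HexVertex, ℝ) :=
  if h : Memℓp (flowField u) 2 then ⟨flowField u, h⟩ else 0

lemma norm_apply_le_of_mem_closedBall (hu : u ∈ closedBall 0 ρ) (i : HexVertex) : ‖u i‖ ≤ ρ :=
  (lp.norm_apply_le_norm two_ne_zero u i).trans (mem_closedBall_zero_iff.1 hu)

namespace CornerAngleEstimate

lemma coe_l2FlowField (hK : CornerAngleEstimate K r) (hu : u ∈ closedBall 0 (r / 2)) :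
    ⇑(l2FlowField u) = flowField u := by
  have hmem : Memℓp (flowField u) 2 := memℓp_of_norm_le_mul_sum
    (g := fun m => l2FwdDiff (hexDir m) u)
    (hK.norm_flowField_le_mul_sum (norm_apply_le_of_mem_closedBall hu))
  rw [l2FlowField, dif_pos hmem]

lemma lipschitzOnWith_l2FlowField (hK : CornerAngleEstimate K r) :
    LipschitzOnWith (24 * K) l2FlowField (closedBall 0 (r / 2)) := by
  refine lipschitzOnWith_iff_norm_sub_le.2 fun u hu v hv => ?_
  calc ‖l2FlowField u - l2FlowField v‖ ≤ 2 * K * ∑ m, ‖l2FwdDiff (hexDir m) (u - v)‖ :=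
        lp_norm_le_mul_sum (by positivity) fun i => by
          rw [lp.coeFn_sub, hK.coe_l2FlowField hu, hK.coe_l2FlowField hv]
          exact hK.norm_flowField_sub_le (norm_apply_le_of_mem_closedBall hu)
            (norm_apply_le_of_mem_closedBall hv) i
    _ ≤ 2 * K * ∑ _m : Fin 6, 2 * ‖u - v‖ := by gcongr; exact norm_l2FwdDiff_le _ _
    _ = ↑(24 * K) * ‖u - v‖ := by
        simp only [Finset.sum_const, Finset.card_univ, Fintype.card_fin, nsmul_eq_mul]
        push_cast
        ring

lemma inner_l2FlowField_le (hK : CornerAngleEstimate K r) (hρr : ρ ≤ r / 2) (hρK : 16 * K * ρ ≤ 1)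
    (hu : u ∈ closedBall 0 ρ) :
    ⟪u, l2FlowField u⟫ ≤ -(1 / 8) * ∑ m, ‖l2FwdDiff (hexDir m) u‖ ^ 2 := by
  have hur := closedBall_subset_closedBall hρr hu
  have hsqrt : (1 : ℝ) / 2 ≤ (√3)⁻¹ := by
    rw [one_div]
    exact inv_anti₀ (by positivity) (Real.sqrt_le_iff.2 (by norm_num))
  have hpoint (i : HexVertex) : ⟪u i, l2FlowField u i⟫ ≤
      (√3)⁻¹ * ∑ m, ⟪u i, l2FwdDiff (hexDir m) u i⟫ +
        2 * K * ρ * ∑ m, (l2FwdDiff (hexDir m) u i) ^ 2 := by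
    simpa only [hK.coe_l2FlowField hur, coe_l2FwdDiff, Real.inner_apply] using
      hK.mul_flowField_le (norm_apply_le_of_mem_closedBall hur) i
        (norm_apply_le_of_mem_closedBall hu i)
  have hsum := ((hasSum_sum fun m (_ : m ∈ Finset.univ) =>
    lp.hasSum_inner (𝕜 := ℝ) u (l2FwdDiff (hexDir m) u)).mul_left (√3)⁻¹).add
      ((hasSum_sum fun m (_ : m ∈ Finset.univ) =>
        hasSum_sq_lp_two (l2FwdDiff (hexDir m) u)).mul_left (2 * K * ρ))
  have hle := hasSum_le hpoint (lp.hasSum_inner u (l2FlowField u)) hsum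
  simp only [inner_l2FwdDiff_self, ← Finset.mul_sum] at hle
  set S := ∑ m, ‖l2FwdDiff (hexDir m) u‖ ^ 2
  calc ⟪u, l2FlowField u⟫ ≤ (2 * K * ρ - (√3)⁻¹ / 2) * S := hle.trans_eq (by ring)
    _ ≤ -(1 / 8) * S := by gcongr; linarith

lemma inner_l2FlowField_le_neg_norm_sq (hK : CornerAngleEstimate K r) (hρr : ρ ≤ r / 2)
    (hρK : 16 * K * ρ ≤ 1) (hu : u ∈ closedBall 0 ρ) (m : Fin 6) :
    ⟪u, l2FlowField u⟫ ≤ -(1 / 8) * ‖l2FwdDiff (hexDir m) u‖ ^ 2 := by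
  have hm : ‖l2FwdDiff (hexDir m) u‖ ^ 2 ≤ ∑ m, ‖l2FwdDiff (hexDir m) u‖ ^ 2 :=
    Finset.single_le_sum (f := fun m => ‖l2FwdDiff (hexDir m) u‖ ^ 2)
      (fun _ _ => sq_nonneg _) (Finset.mem_univ m)
  linarith [hK.inner_l2FlowField_le hρr hρK hu]

end CornerAngleEstimate

end FlowOnL2

section GlobalFlow

variable {K : ℝ≥0} {r ρ : ℝ} {φ : ℓ²(HexVertex, ℝ)} {α : ℝ → ℓ²(HexVertex, ℝ)}

lemma exists_pos_le_quarter_and_mul_le_one (K : ℝ≥0) (hr : 0 < r) :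
    ∃ ρ > 0, ρ ≤ 1 / 4 ∧ ρ ≤ r / 4 ∧ 16 * K * ρ ≤ 1 := by
  have hmul : Tendsto (fun ρ : ℝ => 16 * K * ρ) (𝓝 0) (𝓝 0) :=
    Continuous.tendsto' (by fun_prop) _ _ (mul_zero _)
  have hsmall : ∀ᶠ ρ : ℝ in 𝓝 0, ρ ≤ 1 / 4 ∧ ρ ≤ r / 4 ∧ 16 * K * ρ ≤ 1 :=
    (eventually_le_nhds (by norm_num)).and
      ((eventually_le_nhds (by positivity)).and (hmul.eventually_le_const one_pos))
  have hpos : ∀ᶠ ρ : ℝ in 𝓝[>] 0, 0 < ρ := eventually_mem_nhdsWithin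
  exact (hpos.and (hsmall.filter_mono nhdsWithin_le_nhds)).exists

namespace CornerAngleEstimate

lemma exists_integralCurve_l2FlowField (hK : CornerAngleEstimate K r) (hρ : 0 < ρ)
    (hρr : ρ ≤ r / 2) (hρK : 16 * K * ρ ≤ 1) (hφ : φ ∈ closedBall 0 ρ) :
    ∃ α, α 0 = φ ∧ IsIntegralCurveOn α (fun _ => l2FlowField) (Ici 0) ∧
      MapsTo α (Ici 0) (closedBall 0 ρ) :=
  exists_isIntegralCurveOn_Ici_mapsTo_closedBall hρ
    (hK.lipschitzOnWith_l2FlowField.mono (closedBall_subset_closedBall hρr))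
    (fun u hu => (hK.inner_l2FlowField_le_neg_norm_sq hρr hρK hu 0).trans
      (mul_nonpos_of_nonpos_of_nonneg (by norm_num) (sq_nonneg _))) hφ

lemma tendsto_l2FwdDiff (hK : CornerAngleEstimate K r) (hρr : ρ ≤ r / 2) (hρK : 16 * K * ρ ≤ 1)
    (hα : IsIntegralCurveOn α (fun _ => l2FlowField) (Ici 0))
    (hαρ : MapsTo α (Ici 0) (closedBall 0 ρ)) (m : Fin 6) :
    Tendsto (fun t => l2FwdDiff (hexDir m) (α t)) atTop (𝓝 0) := by
  obtain ⟨M, hM⟩ := exists_norm_le_of_lipschitzOnWith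
    (hK.lipschitzOnWith_l2FlowField.mono (closedBall_subset_closedBall hρr)) isBounded_closedBall
  exact tendsto_zero_of_inner_le_neg_norm_sq _ (by norm_num : (0 : ℝ) < 1 / 8) hM
    (fun u hu => hK.inner_l2FlowField_le_neg_norm_sq hρr hρK hu m) hα hαρ

lemma isGlobalYamabeFlow (hK : CornerAngleEstimate K r) (hρr : ρ ≤ r / 2) (hρ : ρ ≤ 1 / 4)
    (hα₀ : α 0 = φ) (hα : IsIntegralCurveOn α (fun _ => l2FlowField) (Ici 0))
    (hαρ : MapsTo α (Ici 0) (closedBall 0 ρ)) : IsGlobalYamabeFlow φ fun t => α t where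
  initial := congrArg _ hα₀
  metric t ht := isPLMetric_conformalChange_regularMetric fun i =>
    (norm_apply_le_of_mem_closedBall (hαρ ht) i).trans hρ
  flow t ht i := by
    rw [neg_discreteCurvature_conformalChange_regularMetric,
      ← hK.coe_l2FlowField (closedBall_subset_closedBall hρr (hαρ ht))]
    exact (lp.evalCLM ℝ (fun _ : HexVertex => ℝ) 2 i).hasFDerivAt.comp_hasDerivWithinAt t (hα t ht)

lemma eqOn_of_isGlobalYamabeFlow (hK : CornerAngleEstimate K r) {φ : HexVertex → ℝ}
    {u v : ℝ → HexVertex → ℝ} (hu : IsGlobalYamabeFlow φ u) (hv : IsGlobalYamabeFlow φ v)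
    (hur : ∀ t, 0 ≤ t → ∀ i, ‖u t i‖ ≤ r / 4) : EqOn v u (Ici 0) := by
  have hflow {w : ℝ → HexVertex → ℝ} (hw : IsGlobalYamabeFlow φ w) (t : ℝ) (ht : 0 ≤ t)
      (i : HexVertex) : HasDerivWithinAt (fun s => w s i) (flowField (w t) i) (Ici 0) t := by
    rw [← neg_discreteCurvature_conformalChange_regularMetric]
    exact hw.flow t ht i
  exact eqOn_Ici_of_forall_hasDerivWithinAt (L := 24 * K) (by linarith [hK.radius_pos])
    norm_flowField_le
    (fun _ _ hx hy D hD i => hK.norm_flowField_sub_le_of_norm_sub_le hx hy hD i)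
    (hflow hu) (hflow hv) hur (hv.initial.trans hu.initial.symm)

end CornerAngleEstimate

end GlobalFlow

theorem theorem1p7 :
    ∃ ε₀ : ℝ, 0 < ε₀ ∧
      ∀ φ : lp (fun _ : HexVertex => ℝ) 2, ‖φ‖ ≤ ε₀ →
        ∃ u : ℝ → HexVertex → ℝ,
          IsGlobalYamabeFlow φ u ∧
          (∀ v : ℝ → HexVertex → ℝ, IsGlobalYamabeFlow φ v → ∀ t, 0 ≤ t → v t = u t) ∧
          (∀ t, 0 ≤ t → Summable fun e : hexGraph.edgeSet => edgeDiffSq (u t) e) ∧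
          Filter.Tendsto (fun t => dirichletEnergy (u t)) Filter.atTop (nhds 0) ∧
          TendstoUniformlyOn
            (fun t (p : HexVertex × HexVertex) =>
              conformalChange (u t) regularMetric p.1 p.2)
            (fun p => regularMetric p.1 p.2) Filter.atTop
            {p | hexGraph.Adj p.1 p.2} := by
  obtain ⟨K, r, hK⟩ := exists_cornerAngleEstimate
  obtain ⟨ρ, hρ, hρ₄, hρr, hρK⟩ := exists_pos_le_quarter_and_mul_le_one K hK.radius_pos
  have hρr₂ : ρ ≤ r / 2 := by linarith
  refine ⟨ρ, hρ, fun φ hφ => ?_⟩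
  obtain ⟨α, hα₀, hα, hαρ⟩ :=
    hK.exists_integralCurve_l2FlowField hρ hρr₂ hρK (mem_closedBall_zero_iff.2 hφ)
  have hflow := hK.isGlobalYamabeFlow hρr₂ hρ₄ hα₀ hα hαρ
  have hdiff := hK.tendsto_l2FwdDiff hρr₂ hρK hα hαρ
  have hunif : TendstoUniformly (fun t => ⇑(α t)) (fun _ => 0) atTop :=
    tendstoUniformly_zero_of_tendsto_l2FwdDiff injective_nsmul_hexDir_zero
      ((eventually_ge_atTop 0).mono fun t ht => mem_closedBall_zero_iff.1 (hαρ ht)) (hdiff 0)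
  exact ⟨fun t => α t, hflow,
    fun v hv t ht => hK.eqOn_of_isGlobalYamabeFlow hflow hv
      (fun s hs i => (norm_apply_le_of_mem_closedBall (hαρ hs) i).trans hρr) ht,
    fun t _ => summable_edgeDiffSq (α t), tendsto_dirichletEnergy_zero hdiff,
    (tendstoUniformly_conformalChange_regularMetric hunif).tendstoUniformlyOn⟩
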